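/- Let $H$ be a finite connected planar graph (loops and multiple edges allowed) with a fixed plane embedding, given as a rotation system of genus $0$, and let $H^*$ be its dual graph, whose vertices are the faces of $H$ (the outer face included) and in which each edge $e$ of $H$ has a dual edge $e^*$ joining the two faces bounded by $e$. Let $T^*$ be a tree in $H^*$ (not necessarily spanning), and let $H(T^*)$ be the graph on all vertices of $H$ whose edges are the edges $e$ of $H$ with $e^*\notin T^*$. The region tree $R(T^*)$ is obtained by contracting each 2-edge-connected component of $H(T^*)$ to a single vertex, called a region, whose weight is its number of vertices of $H$; the edges of $R(T^*)$ are the bridges of $H(T^*)$. For a region $A$, let $H(A)$ be the corresponding 2-edge-connected component. A region $A$ is a (vertex) center of $R(T^*)$ if every component of $R(T^*)-A$ has total weight at most half the total weight of $R(T^*)$. For a neighbor $B$ of $A$, the subtree of $B$ is the component of $R(T^*)-A$ containing $B$. Refining $R(T^*)$ means replacing $T^*$ by its union with a path of $H^*$ that starts at a face not in $T^*$, repeats no face, and ends as soon as it reaches $T^*$ (a loop-erased walk of Wilson's algorithm). A spanning tree $S$ of $H$ results from refinements of $R(T^*)$ if finitely many (possibly zero) such steps lead from $T^*$ to some $T'^*$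 with $S=\{e : e^*\notin T'^*\}$. It is $0$-splittable if it has an edge whose removal leaves components with exactly half of the vertices of $H$ each. The bridges leaving $A$ within a given face of $H(A)$ are cyclically ordered by the order in which they are met along the boundary of that face; this is the cyclic order of the corresponding neighbors of $A$ induced by the embedding. A set $N$ of neighbors of $A$ is called contiguous if, for each face of $H(A)$, the bridges from $A$ to $N$ within that face form an interval (possibly empty or everything) among all bridges leaving $A$ within that face. Suppose that $A$ is a vertex center of $R(T^*)$ and that some $0$-splittable spanning tree $S$ of $H$ results from refinements of $R(T^*)$. Then: (i) all bridges leaving $A$, except possibly those whose dual edge is a loop of $H^*$ at a face not in $T^*$, lie in one and the same face of $H(A)$, so that they have a single cyclic order (in particular, this holds for all bridges leaving $A$ if $H$ has no bridges, or if every bridge of $H$ borders only on a face that belongs to $T^*$); (ii) the set of neighbors of $A$ in $R(T^*)$ is the disjoint union of two sets $A_1$ and $A_2$ (possibly empty), each contiguous, such that for $i=1,2$ the total weight of the subtrees of the neighbors in $A_i$ is at most half the total weight of $R(T^*)$. -/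

import Mathlib

open Set

/-! ### Multigraphs: darts, reachability, trees

The edges of a multigraph (loops and multiple edges allowed) are the elements of a type `E`. An edge
`e` has two darts (half-edges, or orientations) `(e, false)` and `(e, true)`. A multigraph on the
vertex type `V` is given by the map `t : E × Bool → V` sending a dart to its initial vertex, so that
`e` joins `t (e, false)` and `t (e, true)`. -/

/-- The same edge, in the opposite direction. -/
def Dart.rev {E : Type*} (d : E × Bool) : E × Bool := (d.1, !d.2)

theorem Dart.rev_rev {E : Type*} (d : E × Bool) : Dart.rev (Dart.rev d) = d := by
  simp [Dart.rev]

/-- `u` and `v` are joined by a walk all of whose edges are in `X`. -/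
def Reach {V E : Type*} (t : E × Bool → V) (X : Set E) : V → V → Prop :=
  Relation.ReflTransGen fun u v => ∃ d : E × Bool, d.1 ∈ X ∧ t d = u ∧ t (Dart.rev d) = v

theorem Reach.symm {V E : Type*} {t : E × Bool → V} {X : Set E} {u v : V} (h : Reach t X u v) :
    Reach t X v u := by
  induction h with
  | refl => exact Relation.ReflTransGen.refl
  | tail _ hs ih =>
    obtain ⟨d, hd, h1, h2⟩ := hs
    exact Relation.ReflTransGen.head
      ⟨Dart.rev d, hd, h2, by rw [Dart.rev_rev]; exact h1⟩ ih

/-- `e` is a bridge of the graph with edge set `X`: removing it disconnects its two ends. -/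
def IsBridge {V E : Type*} (t : E × Bool → V) (X : Set E) (e : E) : Prop :=
  e ∈ X ∧ ¬ Reach t (X \ {e}) (t (e, false)) (t (e, true))

/-- A set of vertices and a set of edges. -/
structure Subg (V E : Type*) where
  verts : Set V
  edges : Set E

/-- `T` is a subgraph which is a tree: the ends of its edges are vertices of `T`, it is nonempty and
connected, and it has no cycle (no edge of `T` has its ends joined by a walk in `T` avoiding it). -/
structure Subg.IsTree {V E : Type*} (t : E × Bool → V) (T : Subg V E) : Prop where
  ends_mem : ∀ d : E × Bool, d.1 ∈ T.edges → t d ∈ T.verts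
  nonempty : T.verts.Nonempty
  connected : ∀ u ∈ T.verts, ∀ v ∈ T.verts, Reach t T.edges u v
  acyclic : ∀ e ∈ T.edges, IsBridge t T.edges e

/-- The edge set `S` forms a spanning tree. -/
def IsSpanningTree {V E : Type*} (t : E × Bool → V) (S : Set E) : Prop :=
  Subg.IsTree t ⟨univ, S⟩

/-- The spanning tree `S` has an edge whose removal leaves a `q`-balanced partition: every component
has `n / 2 ± q` vertices, where `n` is the total number of vertices. -/
def IsSplittable {V E : Type*} (t : E × Bool → V) (q : ℝ) (S : Set E) : Prop :=
  ∃ e ∈ S, ∀ v : V, |({u | Reach t (S \ {e}) v u}.ncard : ℝ) - (Nat.card V : ℝ) / 2| ≤ q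

/-! ### Plane graphs -/

open Classical in
/-- Reverse the darts of the edges in `Y`, and fix the other darts. -/
noncomputable def flipOn {E : Type*} (Y : Set E) : Equiv.Perm (E × Bool) :=
  Function.Involutive.toPerm (fun d => if d.1 ∈ Y then Dart.rev d else d) (by
    intro d
    by_cases h : d.1 ∈ Y
    · have h' : (Dart.rev d).1 ∈ Y := h
      simp only [if_pos h, if_pos h', Dart.rev_rev]
    · simp only [if_neg h])

/-- Let `rot d` be the dart following `d` in counterclockwise order around the initial vertex of `d`.
The permutation `contour rot Y` follows the boundaries of the faces of the subgraph with edge set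
`Y`: a dart of an edge of `Y` is traversed, and the next dart around the vertex reached comes next;
a dart of any other edge is passed by (it is met, but not traversed), and the next dart around the
same vertex comes next. -/
noncomputable def contour {E : Type*} (rot : Equiv.Perm (E × Bool)) (Y : Set E) :
    Equiv.Perm (E × Bool) :=
  (flipOn Y).trans rot

/-- A connected graph with vertices `V` and edges `E`, embedded in the plane (or the sphere) with
faces `F`, as a combinatorial map: `rot` is the rotation system, the cycles of `rot` are the sets
of darts leaving the vertices, the cycles of `contour rot univ` are the boundary walks of the
faces, and the genus is zero by Euler's formula. -/
structure PlaneGraph (V E F : Type*) where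
  /-- the initial vertex of a dart -/
  vert : E × Bool → V
  /-- the face on a fixed side of a dart; the two faces bounded by `e` are `face (e, false)` and
  `face (e, true)` -/
  face : E × Bool → F
  /-- the next dart in the counterclockwise order around the initial vertex -/
  rot : Equiv.Perm (E × Bool)
  vert_eq_iff : ∀ d d', vert d = vert d' ↔ rot.SameCycle d d'
  face_eq_iff : ∀ d d', face d = face d' ↔ (contour rot univ).SameCycle d d'
  nonempty : Nonempty V
  connected : ∀ u v, Reach vert univ u v
  /-- every face has a boundary edge, unless the graph is a single vertex without edges -/
  face_surjective : Nonempty E → Function.Surjective face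
  euler : Nat.card V + Nat.card F = Nat.card E + 2

namespace PlaneGraph

variable {V E F : Type*} (H : PlaneGraph V E F)

/-- `T` is a tree in the dual graph of `H`, which has vertex set `F` and in which the dual of the edge
`e` joins the two faces bounded by `e`. We identify `e` with its dual edge. -/
def IsDualTree (T : Subg F E) : Prop := T.IsTree H.face

/-- `T'` is obtained from `T` by adding a completed loop-erased walk in the dual graph: a path that
starts at a face not in `T`, does not repeat a face, and ends as soon as it reaches `T`. The list `p`
consists of the successive edges of the path, directed along the path. -/
def WilsonStep (T T' : Subg F E) : Prop :=
  ∃ p : List (E × Bool), p ≠ [] ∧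
    p.IsChain (fun d d' => H.face (Dart.rev d) = H.face d') ∧
    (p.map H.face).Nodup ∧
    (∀ d ∈ p, H.face d ∉ T.verts) ∧
    (∀ d ∈ p.getLast?, H.face (Dart.rev d) ∈ T.verts) ∧
    T'.verts = T.verts ∪ {f | ∃ d ∈ p, H.face d = f} ∧
    T'.edges = T.edges ∪ {e | ∃ d ∈ p, d.1 = e}

/-! ### The region tree

`H(T)` is the graph on all vertices of `H` whose edges are the edges of `H` with dual not in `T`. -/

/-- The relation of being in the same 2-edge-connected component of `H(T)`: being connected in
`H(T)` and after the removal of any one edge. -/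
def regionSetoid (T : Subg F E) : Setoid V where
  r u v := Reach H.vert T.edgesᶜ u v ∧ ∀ e, Reach H.vert (T.edgesᶜ \ {e}) u v
  iseqv :=
    { refl := fun _ => ⟨Relation.ReflTransGen.refl, fun _ => Relation.ReflTransGen.refl⟩
      symm := fun h => ⟨h.1.symm, fun e => (h.2 e).symm⟩
      trans := fun h h' => ⟨h.1.trans h'.1, fun e => (h.2 e).trans (h'.2 e)⟩ }

/-- The regions, that is, the 2-edge-connected components of `H(T)`. -/
def Region (T : Subg F E) : Type _ := Quotient (H.regionSetoid T)

/-- The region containing a vertex. -/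
def region (T : Subg F E) (v : V) : H.Region T := Quotient.mk (H.regionSetoid T) v

/-- `d` is a bridge of `H(T)` directed out of the region `A`. -/
def IsExit (T : Subg F E) (A : H.Region T) (d : E × Bool) : Prop :=
  IsBridge H.vert T.edgesᶜ d.1 ∧ H.region T (H.vert d) = A

/-- The region entered through a dart. -/
def target (T : Subg F E) (d : E × Bool) : H.Region T := H.region T (H.vert (Dart.rev d))

theorem IsExit.rev {T : Subg F E} {d : E × Bool} {A : H.Region T} (h : H.IsExit T A d) :
    H.IsExit T (H.target T d) (Dart.rev d) := ⟨h.1, rfl⟩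

theorem IsExit.target_ne {T : Subg F E} {d : E × Bool} {A : H.Region T} (h : H.IsExit T A d) :
    H.target T d ≠ A := by
  intro h'
  have h2 : H.region T (H.vert (Dart.rev d)) = H.region T (H.vert d) := h'.trans h.2.symm
  have h3 := (Quotient.exact h2).2 d.1
  obtain ⟨e, b⟩ := d
  cases b
  · exact h.1.2 (Reach.symm h3)
  · exact h.1.2 h3

/-- The region tree: its vertices are the regions, its edges the bridges of `H(T)`. -/
def regionTree (T : Subg F E) : SimpleGraph (H.Region T) where
  Adj A B := ∃ d, H.IsExit T A d ∧ H.target T d = B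
  symm := ⟨by
    rintro A B ⟨d, hd, rfl⟩
    exact ⟨Dart.rev d, hd.rev, by
      show H.region T (H.vert (Dart.rev (Dart.rev d))) = A
      rw [Dart.rev_rev]; exact hd.2⟩⟩
  loopless := ⟨by
    rintro A ⟨d, hd, h⟩
    exact hd.target_ne H h⟩

/-- The weight of a region is its number of vertices. -/
noncomputable def weight (T : Subg F E) (A : H.Region T) : ℕ := {v | H.region T v = A}.ncard

/-- The total weight of a set of regions. -/
noncomputable def totalWeight (T : Subg F E) (s : Set (H.Region T)) : ℕ :=
  ∑ᶠ B ∈ s, H.weight T B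

/-- For a region `B ≠ A`: the subtree containing `B` when `A` is removed from the region tree. -/
def subtree (T : Subg F E) (A B : H.Region T) : Set (H.Region T) :=
  {C | ((H.regionTree T).deleteIncidenceSet A).Reachable B C}

/-- `A` is a center of the region tree: its removal leaves subtrees of weight at most half of the
total weight. -/
def IsVertexCenter (T : Subg F E) (A : H.Region T) : Prop :=
  ∀ B, B ≠ A → 2 * H.totalWeight T (H.subtree T A B) ≤ H.totalWeight T univ

/-- `S` is a spanning tree of `H` that can be obtained by refining the region tree of `T`: after
adding finitely many loop-erased walks to `T`, the remaining edges of `H` are those of `S`. -/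
def IsObtainedByRefining (T : Subg F E) (S : Set E) : Prop :=
  IsSpanningTree H.vert S ∧ ∃ T', Relation.ReflTransGen H.WilsonStep T T' ∧ T'.edgesᶜ = S

/-! ### The cyclic order of the neighbors of a region -/

/-- The edges of the 2-edge-connected component `H(A)`. -/
def innerEdges (T : Subg F E) (A : H.Region T) : Set E :=
  {e | e ∈ T.edgesᶜ ∧ ∀ b, H.region T (H.vert (e, b)) = A}

/-- The cyclic order around the region `A`: the cycles of this permutation on the darts leaving
vertices of `A` correspond to the faces of the plane graph `H(A)`, and each cycle lists these darts,
in particular the bridges leaving `A` within that face, in the order in which they are met along the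
boundary of the face. -/
noncomputable def around (T : Subg F E) (A : H.Region T) : Equiv.Perm (E × Bool) :=
  contour H.rot (H.innerEdges T A)

/-- The set `N` of neighbors of `A` is contiguous in the cyclic order around `A`: around each face of
`H(A)`, the bridges from `A` to `N` are exactly those bridges out of `A` that are met in some
interval `d, π d, …, π ^ (k - 1) d` of the cyclic order `π`. -/
def IsContiguous (T : Subg F E) (A : H.Region T) (N : Set (H.Region T)) : Prop :=
  ∀ c : E × Bool, ∃ (d : E × Bool) (k : ℕ), ∀ x, H.IsExit T A x → (H.around T A).SameCycle c x →
    (H.target T x ∈ N ↔ ∃ i < k, x = ((H.around T A) ^ i) d)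

end PlaneGraph

/-!
The argument rests on a combinatorial Jordan curve theorem, `not_sameCycle_contour_of_reach`: if an
edge lies on a cycle of the subgraph with edge set `Y`, then its two darts lie on different cycles of
`contour H.rot Y`. Adding an edge to `Y` composes the contour permutation with a transposition, so it
joins two contours or splits one. Hence `2 * #components + #edges - #contours` never decreases when
an edge is added, and it increases if the edge joins two contours within one component. As Euler's
formula makes it equal for the empty subgraph and for the whole graph, the latter never happens.
Consequently two darts on one contour stay on one contour after edges are deleted, as long as their
vertices stay connected (`sameCycle_contour_of_subset`).

For the first claim, let `X` be the set of edges with dual not in `T`. The contours of `X` only run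
through faces connected by `T`, so both sides of a bridge of `X` are the same face or belong to `T`.
The faces of `T` are merged into a single contour of `X`, hence into a single contour of `H(A)`.

For the second claim, let `e` be the splitting edge of `S`. The tree `S` contains all bridges of `X`,
and its restriction to a region spans that region. If `e` is not an edge of `H(A)`, then `S \ {e}` still
connects `A`, and its other component is contained in the subtree of a single neighbor of `A`, which
forms one of the two groups; the other neighbors have at most the other half. If `e` is an edge of
`H(A)`, then the neighbors are grouped by the component of `S \ {e}` to which they are attached, and
these components contain the subtrees. The edges of `H(A)` between the two components form a bond,
so every contour of `H(A)` passes from one side to the other at most once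
(`eq_of_sameCycle_contour_of_leave`), which makes both groups contiguous
(`Equiv.Perm.exists_interval`).
-/

/-! ### Counting the classes of an equivalence relation -/

theorem natCard_quotient_le_of_le {α : Type*} [Finite α] {r s : Setoid α} (h : r ≤ s) :
    Nat.card (Quotient s) ≤ Nat.card (Quotient r) := by
  refine Nat.card_le_card_of_surjective (Quotient.map' id h) ?_
  rintro ⟨x⟩
  exact ⟨Quotient.mk r x, rfl⟩

theorem natCard_quotient_lt_of_le {α : Type*} [Finite α] {r s : Setoid α} (h : r ≤ s) {a b : α}
    (hr : ¬ r a b) (hs : s a b) : Nat.card (Quotient s) < Nat.card (Quotient r) := by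
  have hsurj : Function.Surjective (Quotient.map' (s₁ := r) (s₂ := s) id h) := by
    rintro ⟨x⟩
    exact ⟨Quotient.mk r x, rfl⟩
  refine lt_of_le_of_ne (natCard_quotient_le_of_le h) fun hcard => hr ?_
  have hbij := (Nat.bijective_iff_surjective_and_card _).2 ⟨hsurj, hcard.symm⟩
  exact Quotient.exact (hbij.1 (a₁ := Quotient.mk r a) (a₂ := Quotient.mk r b) (Quotient.sound hs))

/-- If `s` identifies no more than `r` and the pair `(a, b)` together do, then `s` has at most one
class less than `r`. -/
theorem natCard_quotient_le_succ {α : Type*} [Finite α] {r s : Setoid α} {a b : α}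
    (h : ∀ x y, s x y → r x y ∨ (r x a ∧ r b y) ∨ (r x b ∧ r a y)) :
    Nat.card (Quotient r) ≤ Nat.card (Quotient s) + 1 := by
  classical
  rw [← Finite.card_option]
  refine Nat.card_le_card_of_injective
    (fun x : Quotient r => if x = Quotient.mk r b then none else some (Quotient.mk s x.out)) ?_
  intro x y hxy
  dsimp only at hxy
  split_ifs at hxy with hx hy hy
  · rw [hx, hy]
  · have hs : s x.out y.out := Quotient.exact (Option.some.inj hxy)
    rcases h _ _ hs with h | ⟨_, h⟩ | ⟨h, _⟩
    · rw [← x.out_eq, ← y.out_eq]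
      exact Quotient.sound h
    · exact absurd (y.out_eq.symm.trans (Quotient.sound (r.symm h))) hy
    · exact absurd (x.out_eq.symm.trans (Quotient.sound h)) hx

/-! ### Cycles of a permutation -/

namespace Equiv.Perm

theorem SameCycle.induction {α : Type*} [Finite α] {σ : Perm α} {x y : α} (h : σ.SameCycle x y)
    {p : α → Prop} (hx : p x) (hσ : ∀ z, σ.SameCycle x z → p z → p (σ z)) : p y := by
  obtain ⟨n, rfl⟩ := h.exists_nat_pow_eq
  clear h
  induction n with
  | zero => simpa using hx
  | succ n ih =>
    rw [pow_succ', mul_apply]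
    exact hσ _ ⟨n, by simp⟩ ih

theorem SameCycle.of_mul_swap {α : Type*} [Finite α] [DecidableEq α] {σ : Perm α} {a b x y : α}
    (h : (σ * swap a b).SameCycle x y) :
    σ.SameCycle x y ∨ (σ.SameCycle x a ∧ σ.SameCycle b y) ∨ (σ.SameCycle x b ∧ σ.SameCycle a y) := by
  refine h.induction (p := fun y => σ.SameCycle x y ∨ (σ.SameCycle x a ∧ σ.SameCycle b y) ∨
    (σ.SameCycle x b ∧ σ.SameCycle a y)) (Or.inl (SameCycle.refl _ _)) fun z _ hz => ?_
  rw [mul_apply]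
  by_cases hza : z = a
  · subst hza
    rw [swap_apply_left, sameCycle_apply_right, sameCycle_apply_right, sameCycle_apply_right]
    rcases hz with h | ⟨h, _⟩ | ⟨h, _⟩
    · exact Or.inr (Or.inl ⟨h, SameCycle.refl _ _⟩)
    · exact Or.inr (Or.inl ⟨h, SameCycle.refl _ _⟩)
    · exact Or.inl h
  by_cases hzb : z = b
  · subst hzb
    rw [swap_apply_right, sameCycle_apply_right, sameCycle_apply_right, sameCycle_apply_right]
    rcases hz with h | ⟨h, _⟩ | ⟨h, _⟩
    · exact Or.inr (Or.inr ⟨h, SameCycle.refl _ _⟩)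
    · exact Or.inl h
    · exact Or.inr (Or.inr ⟨h, SameCycle.refl _ _⟩)
  rw [swap_apply_of_ne_of_ne hza hzb]
  simpa only [sameCycle_apply_right] using hz

/-- Composing with the transposition of two elements of different cycles joins these cycles. -/
theorem sameCycle_mul_swap {α : Type*} [Finite α] [DecidableEq α] {σ : Perm α} {a b : α}
    (h : ¬ σ.SameCycle a b) : (σ * swap a b).SameCycle a b := by
  have hstep : ∀ z, σ.SameCycle (σ b) z → (σ * swap a b).SameCycle a z := by
    intro z hz
    refine hz.induction ?_ fun w hw ih => ?_
    · exact ⟨1, by simp⟩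
    · by_cases hwb : w = b
      · exact ⟨1, by simp [hwb]⟩
      · have hwa : w ≠ a := by
          rintro rfl
          exact h (sameCycle_apply_left.1 hw).symm
        have : (σ * swap a b) w = σ w := by rw [mul_apply, swap_apply_of_ne_of_ne hwa hwb]
        rw [← this]
        exact ih.apply_right
  exact hstep b (sameCycle_apply_left.2 (SameCycle.refl _ _))

theorem SameCycle.mul_swap {α : Type*} [Finite α] [DecidableEq α] {σ : Perm α} {a b x y : α}
    (h : ¬ σ.SameCycle a b) (hxy : σ.SameCycle x y) : (σ * swap a b).SameCycle x y := by
  have hab := sameCycle_mul_swap h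
  refine hxy.induction (SameCycle.refl _ _) fun z _ hz => hz.trans ?_
  by_cases hza : z = a
  · subst hza
    exact hab.trans ⟨1, by simp⟩
  by_cases hzb : z = b
  · subst hzb
    exact hab.symm.trans ⟨1, by simp⟩
  · exact ⟨1, by simp [swap_apply_of_ne_of_ne hza hzb]⟩

/-- A property which is lost at most once along a cycle holds on an interval of the cycle. -/
theorem exists_interval {α : Type*} [Finite α] (σ : Perm α) (p : α → Prop) (c : α)
    (h : ∀ x y, σ.SameCycle c x → σ.SameCycle c y → p x → ¬ p (σ x) → p y → ¬ p (σ y) → x = y) :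
    ∃ (d : α) (k : ℕ), ∀ x, σ.SameCycle c x → (p x ↔ ∃ i < k, x = (σ ^ i) d) := by
  classical
  by_cases hall : ∀ x, σ.SameCycle c x → p x
  · refine ⟨c, Nat.card α + 1 + orderOf σ, fun x hx => ⟨fun _ => ?_, fun _ => hall x hx⟩⟩
    obtain ⟨n, rfl⟩ := hx.exists_nat_pow_eq
    refine ⟨n % orderOf σ, ?_, by rw [pow_mod_orderOf]⟩
    have := Nat.mod_lt n (orderOf_pos σ)
    omega
  push Not at hall
  obtain ⟨z, hcz, hz⟩ := hall
  by_cases hnone : ∀ x, σ.SameCycle c x → ¬ p x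
  · exact ⟨c, 0, fun x hx => by simp [hnone x hx]⟩
  push Not at hnone
  obtain ⟨y, hcy, hy⟩ := hnone
  -- the property is gained somewhere, at `σ w`
  obtain ⟨w, hcw, hw, hw'⟩ : ∃ w, σ.SameCycle c w ∧ ¬ p w ∧ p (σ w) := by
    by_contra! hno
    exact (hcz.symm.trans hcy).induction (p := fun x => ¬ p x) hz
      (fun x hx hpx => hno x (hcz.trans hx) hpx) hy
  -- from every point with the property, the next point of loss is reached
  have hloss : ∀ x, σ.SameCycle c x → p x → ∃ m, (∀ i ≤ m, p ((σ ^ i) x)) ∧ ¬ p ((σ ^ (m + 1)) x) := by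
    intro x hx hpx
    have hex : ∃ n, ¬ p ((σ ^ n) x) := by
      obtain ⟨n, hn⟩ := (hx.symm.trans hcz).exists_nat_pow_eq
      exact ⟨n, hn ▸ hz⟩
    have hpos : Nat.find hex ≠ 0 := by
      intro h0
      have := Nat.find_spec hex
      rw [h0] at this
      exact this (by simpa using hpx)
    refine ⟨Nat.find hex - 1, fun i hi => ?_, ?_⟩
    · exact not_not.1 (Nat.find_min hex (m := i) (by omega))
    · rw [Nat.sub_add_cancel (by omega)]
      exact Nat.find_spec hex
  have hcd : σ.SameCycle c (σ w) := hcw.apply_right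
  obtain ⟨k, hk, hk'⟩ := hloss (σ w) hcd hw'
  refine ⟨σ w, k + 1, fun x hx => ⟨fun hpx => ?_, ?_⟩⟩
  · obtain ⟨m, hm, hm'⟩ := hloss x hx hpx
    have heq : (σ ^ m) x = (σ ^ k) (σ w) := by
      refine h _ _ (hx.trans ⟨m, by simp⟩) (hcd.trans ⟨k, by simp⟩) (hm m le_rfl) ?_ (hk k le_rfl) ?_
      · rwa [← mul_apply, ← pow_succ']
      · rwa [← mul_apply, ← pow_succ']
    rcases le_or_gt m k with hmk | hmk
    · refine ⟨k - m, by omega, (σ ^ m).injective ?_⟩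
      rw [heq, ← mul_apply (σ ^ m), ← pow_add, Nat.add_sub_cancel' hmk]
    · -- the run of the property from `x` to its loss would pass through `w`
      refine absurd (hm (m - (k + 1)) (by omega)) ?_
      have : (σ ^ (m - (k + 1))) x = w := by
        apply (σ ^ (k + 1)).injective
        rw [← mul_apply, ← pow_add, Nat.add_sub_cancel' (by omega), heq, pow_succ, mul_apply]
      rwa [this]
  · rintro ⟨i, hi, rfl⟩
    exact hk i (by omega)

end Equiv.Perm

/-! ### Reachability in multigraphs -/

section Reach

variable {V E : Type*} {t : E × Bool → V} {X Y : Set E} {u v w : V}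

theorem Reach.refl : Reach t X u u := Relation.ReflTransGen.refl

theorem Reach.trans (h : Reach t X u v) (h' : Reach t X v w) : Reach t X u w :=
  Relation.ReflTransGen.trans h h'

theorem Reach.mono (h : Reach t X u v) (hXY : X ⊆ Y) : Reach t Y u v :=
  Relation.ReflTransGen.mono (fun _ _ ⟨d, hd, h⟩ => ⟨d, hXY hd, h⟩) _ _ h

theorem Reach.of_mem {d : E × Bool} (hd : d.1 ∈ X) : Reach t X (t d) (t (Dart.rev d)) :=
  Relation.ReflTransGen.single ⟨d, hd, rfl, rfl⟩

theorem Reach.induction (h : Reach t X u v) {p : V → Prop} (hu : p u)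
    (hd : ∀ d : E × Bool, d.1 ∈ X → Reach t X u (t d) → p (t d) → p (t (Dart.rev d))) : p v := by
  induction h with
  | refl => exact hu
  | tail h hs ih =>
    obtain ⟨d, hdX, rfl, rfl⟩ := hs
    exact hd d hdX h ih

/-- The connected components of the graph with edge set `X`. -/
def reachSetoid (t : E × Bool → V) (X : Set E) : Setoid V where
  r := Reach t X
  iseqv := ⟨fun _ => Reach.refl, Reach.symm, Reach.trans⟩

theorem Dart.eq_or_eq_rev {d d' : E × Bool} (h : d'.1 = d.1) : d' = d ∨ d' = Dart.rev d := by
  obtain ⟨e, b⟩ := d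
  obtain ⟨e', b'⟩ := d'
  obtain rfl : e' = e := h
  cases b <;> cases b' <;> simp [Dart.rev]

theorem Reach.avoid_or (h : Reach t X u v) (d : E × Bool) :
    Reach t (X \ {d.1}) u v ∨ (Reach t (X \ {d.1}) u (t d) ∧ Reach t (X \ {d.1}) (t (Dart.rev d)) v) ∨
      (Reach t (X \ {d.1}) u (t (Dart.rev d)) ∧ Reach t (X \ {d.1}) (t d) v) := by
  refine h.induction (p := fun v => Reach t (X \ {d.1}) u v ∨
    (Reach t (X \ {d.1}) u (t d) ∧ Reach t (X \ {d.1}) (t (Dart.rev d)) v) ∨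
      (Reach t (X \ {d.1}) u (t (Dart.rev d)) ∧ Reach t (X \ {d.1}) (t d) v)) (Or.inl .refl) ?_
  intro d' hd' _ ih
  by_cases he : d'.1 = d.1
  · rcases Dart.eq_or_eq_rev he with rfl | rfl
    · rcases ih with h | ⟨h, _⟩ | ⟨h, _⟩
      · exact Or.inr (Or.inl ⟨h, .refl⟩)
      · exact Or.inr (Or.inl ⟨h, .refl⟩)
      · exact Or.inl h
    · rw [Dart.rev_rev]
      rcases ih with h | ⟨h, _⟩ | ⟨h, _⟩
      · exact Or.inr (Or.inr ⟨h, .refl⟩)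
      · exact Or.inl h
      · exact Or.inr (Or.inr ⟨h, .refl⟩)
  · have hs : Reach t (X \ {d.1}) (t d') (t (Dart.rev d')) := Reach.of_mem ⟨hd', he⟩
    exact ih.imp (·.trans hs) (Or.imp (And.imp_right (·.trans hs)) (And.imp_right (·.trans hs)))

theorem isBridge_iff (d : E × Bool) :
    IsBridge t X d.1 ↔ d.1 ∈ X ∧ ¬ Reach t (X \ {d.1}) (t d) (t (Dart.rev d)) := by
  obtain ⟨e, b⟩ := d
  cases b
  · exact Iff.rfl
  · exact and_congr_right fun _ => not_congr ⟨Reach.symm, Reach.symm⟩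

theorem IsBridge.not_reach {d : E × Bool} (h : IsBridge t X d.1) :
    ¬ Reach t (X \ {d.1}) (t d) (t (Dart.rev d)) := ((isBridge_iff d).1 h).2

/-- A connected spanning subgraph contains every bridge. -/
theorem IsBridge.mem_of_subset {e : E} (h : IsBridge t X e) (hY : Y ⊆ X)
    (hconn : ∀ u v, Reach t Y u v) : e ∈ Y := by
  by_contra he
  exact h.2 ((hconn _ _).mono fun x hx => ⟨hY hx, fun hxe => he (hxe ▸ hx)⟩)

/-- A walk between two vertices which no edge of `X` separates need not use the bridges of `X`. -/
theorem Reach.diff_bridges [Finite E] (h : Reach t Y u v) (hY : Y ⊆ X)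
    (huv : ∀ e, Reach t (X \ {e}) u v) : Reach t (Y \ {e | IsBridge t X e}) u v := by
  suffices ∀ B : Set E, B ⊆ {e | IsBridge t X e} → Reach t (Y \ B) u v from this _ Subset.rfl
  intro B
  induction B, B.toFinite using Set.Finite.induction_on with
  | empty => intro _; simpa using h
  | @insert e B _ _ ih =>
    intro hB
    have hbr : IsBridge t X e := hB (mem_insert _ _)
    have ih := ih ((subset_insert _ _).trans hB)
    have hsub : (Y \ B) \ {e} ⊆ X \ {e} := fun x hx => ⟨hY hx.1.1, hx.2⟩
    rw [show Y \ insert e B = (Y \ B) \ {e} by ext; simp; tauto]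
    rcases ih.avoid_or (e, false) with h | ⟨h1, h2⟩ | ⟨h1, h2⟩
    · exact h
    · exact absurd (((h1.mono hsub).symm.trans (huv e)).trans (h2.mono hsub).symm) hbr.2
    · exact absurd (((h2.mono hsub).trans (huv e).symm).trans (h1.mono hsub)) hbr.2

end Reach

/-! ### Contours in a plane graph -/

section contour

variable {V E F : Type*} {rot : Equiv.Perm (E × Bool)} {X Y : Set E} {d : E × Bool}

theorem contour_of_mem (h : d.1 ∈ Y) : contour rot Y d = rot (Dart.rev d) :=
  congrArg rot (if_pos h)

theorem contour_of_notMem (h : d.1 ∉ Y) : contour rot Y d = rot d :=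
  congrArg rot (if_neg h)

theorem contour_eq_mul_swap [DecidableEq E] (d : E × Bool) (hd : d.1 ∈ Y) :
    contour rot Y = contour rot (Y \ {d.1}) * Equiv.swap d (Dart.rev d) := by
  ext1 x
  rw [Equiv.Perm.mul_apply]
  by_cases hx : x.1 = d.1
  · have hY : x.1 ∈ Y := hx ▸ hd
    rcases Dart.eq_or_eq_rev hx with rfl | rfl
    · rw [Equiv.swap_apply_left, contour_of_mem hY, contour_of_notMem (by simp [Dart.rev])]
    · rw [Equiv.swap_apply_right, contour_of_mem hY, contour_of_notMem (by simp), Dart.rev_rev]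
  · rw [Equiv.swap_apply_of_ne_of_ne (by rintro rfl; exact hx rfl) (by rintro rfl; exact hx rfl)]
    by_cases hY : x.1 ∈ Y
    · rw [contour_of_mem hY, contour_of_mem (Y := Y \ {d.1}) ⟨hY, hx⟩]
    · rw [contour_of_notMem hY, contour_of_notMem fun h => hY h.1]

theorem contour_diff_eq_mul_swap [DecidableEq E] (d : E × Bool) (hd : d.1 ∈ Y) :
    contour rot (Y \ {d.1}) = contour rot Y * Equiv.swap d (Dart.rev d) := by
  rw [contour_eq_mul_swap d hd, Equiv.mul_swap_mul_self]

end contour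

namespace PlaneGraph

variable {V E F : Type*} (H : PlaneGraph V E F) {X Y : Set E} {d x y : E × Bool}

theorem vert_rot (d : E × Bool) : H.vert (H.rot d) = H.vert d :=
  (H.vert_eq_iff _ _).2 (Equiv.Perm.sameCycle_apply_left.2 (.refl _ _))

theorem vert_contour_of_mem (h : d.1 ∈ Y) :
    H.vert (contour H.rot Y d) = H.vert (Dart.rev d) := by
  rw [contour_of_mem h, vert_rot]

theorem vert_contour_of_notMem (h : d.1 ∉ Y) : H.vert (contour H.rot Y d) = H.vert d := by
  rw [contour_of_notMem h, vert_rot]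

theorem face_rot_rev (d : E × Bool) : H.face (H.rot (Dart.rev d)) = H.face d := by
  rw [← contour_of_mem (mem_univ d.1)]
  exact (H.face_eq_iff _ _).2 (Equiv.Perm.sameCycle_apply_left.2 (.refl _ _))

theorem face_rot (d : E × Bool) : H.face (H.rot d) = H.face (Dart.rev d) := by
  rw [← H.face_rot_rev (Dart.rev d), Dart.rev_rev]

theorem reach_vert_contour (Y : Set E) (d : E × Bool) :
    Reach H.vert Y (H.vert d) (H.vert (contour H.rot Y d)) := by
  by_cases h : d.1 ∈ Y
  · rw [H.vert_contour_of_mem h]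
    exact Reach.of_mem h
  · rw [H.vert_contour_of_notMem h]
    exact Reach.refl

theorem reach_of_sameCycle_contour [Finite E] (h : (contour H.rot Y).SameCycle x y) :
    Reach H.vert Y (H.vert x) (H.vert y) :=
  h.induction (p := fun z => Reach H.vert Y (H.vert x) (H.vert z)) .refl
    fun z _ hz => hz.trans (H.reach_vert_contour Y z)

/-- The contours of the complement of a set `Z` of edges only run through faces of `H` which are
connected in the dual graph by edges of `Z`. -/
theorem reach_face_of_sameCycle_contour [Finite E] {Z : Set E}
    (h : (contour H.rot Zᶜ).SameCycle x y) : Reach H.face Z (H.face x) (H.face y) := by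
  refine h.induction (p := fun z => Reach H.face Z (H.face x) (H.face z)) .refl
    fun z _ hz => hz.trans ?_
  by_cases hZ : z.1 ∈ Z
  · rw [contour_of_notMem (notMem_compl_iff.2 hZ), face_rot]
    exact Reach.of_mem hZ
  · rw [contour_of_mem hZ, face_rot_rev]
    exact Reach.refl

/-- Twice the number of components plus the number of edges minus the number of contours of the graph
with edge set `Y`. For a rotation system of genus zero, this is the number of vertices for every
`Y`; every unit of genus of the subgraph would add two to it. -/
noncomputable def eulerDefect (Y : Set E) : ℤ :=
  2 * Nat.card (Quotient (reachSetoid H.vert Y)) + Y.ncard -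
    Nat.card (Quotient (Equiv.Perm.SameCycle.setoid (contour H.rot Y)))

theorem reachSetoid_le_of_reach
    (hr : Reach H.vert (Y \ {d.1}) (H.vert d) (H.vert (Dart.rev d))) :
    reachSetoid H.vert Y ≤ reachSetoid H.vert (Y \ {d.1}) := by
  intro u v (h : Reach _ _ u v)
  rcases h.avoid_or d with h | ⟨h, h'⟩ | ⟨h, h'⟩
  · exact h
  · exact (h.trans hr).trans h'
  · exact (h.trans hr.symm).trans h'

theorem sameCycle_contour_of_not_reach [Finite E] (hd : d.1 ∈ Y)
    (h : ¬ Reach H.vert (Y \ {d.1}) (H.vert d) (H.vert (Dart.rev d))) :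
    (contour H.rot Y).SameCycle d (Dart.rev d) := by
  classical
  rw [contour_eq_mul_swap d hd]
  exact Equiv.Perm.sameCycle_mul_swap fun hc => h (H.reach_of_sameCycle_contour hc)

/-- Adding an edge which joins two vertices of one component in different contours, that is, adding
a handle to the surface, increases the defect. -/
theorem eulerDefect_diff_lt [Finite V] [Finite E] (hd : d.1 ∈ Y)
    (hr : Reach H.vert (Y \ {d.1}) (H.vert d) (H.vert (Dart.rev d)))
    (hc : (contour H.rot Y).SameCycle d (Dart.rev d)) :
    H.eulerDefect (Y \ {d.1}) < H.eulerDefect Y := by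
  classical
  have hcard : (Y \ {d.1}).ncard + 1 = Y.ncard := ncard_sdiff_singleton_add_one hd
  have hk := natCard_quotient_le_of_le (H.reachSetoid_le_of_reach hr)
  have : Nat.card (Quotient (Equiv.Perm.SameCycle.setoid (contour H.rot Y))) ≤
      Nat.card (Quotient (Equiv.Perm.SameCycle.setoid (contour H.rot (Y \ {d.1})))) := by
    refine natCard_quotient_le_of_le fun x y (h : Equiv.Perm.SameCycle _ x y) => ?_
    rw [contour_diff_eq_mul_swap d hd] at h
    rcases h.of_mul_swap with h | ⟨h, h'⟩ | ⟨h, h'⟩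
    · exact h
    · exact (h.trans hc).trans h'
    · exact (h.trans hc.symm).trans h'
  unfold eulerDefect
  omega

/-- An edge within one component adds at most one contour; an edge between two components joins their
contours. -/
theorem eulerDefect_diff_le [Finite V] [Finite E] (hd : d.1 ∈ Y) :
    H.eulerDefect (Y \ {d.1}) ≤ H.eulerDefect Y := by
  classical
  have hcard : (Y \ {d.1}).ncard + 1 = Y.ncard := ncard_sdiff_singleton_add_one hd
  by_cases hr : Reach H.vert (Y \ {d.1}) (H.vert d) (H.vert (Dart.rev d))
  · by_cases hc : (contour H.rot Y).SameCycle d (Dart.rev d)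
    · exact (H.eulerDefect_diff_lt hd hr hc).le
    have hk := natCard_quotient_le_of_le (H.reachSetoid_le_of_reach hr)
    have : Nat.card (Quotient (Equiv.Perm.SameCycle.setoid (contour H.rot Y))) ≤
        Nat.card (Quotient (Equiv.Perm.SameCycle.setoid (contour H.rot (Y \ {d.1})))) + 1 := by
      refine natCard_quotient_le_succ (a := d) (b := Dart.rev d)
        fun x y (h : Equiv.Perm.SameCycle _ x y) => ?_
      rw [contour_diff_eq_mul_swap d hd] at h
      exact h.of_mul_swap
    unfold eulerDefect
    omega
  · have hk : Nat.card (Quotient (reachSetoid H.vert (Y \ {d.1}))) ≤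
        Nat.card (Quotient (reachSetoid H.vert Y)) + 1 :=
      natCard_quotient_le_succ (a := H.vert d) (b := H.vert (Dart.rev d))
        fun u v (h : Reach _ _ u v) => h.avoid_or d
    have : Nat.card (Quotient (Equiv.Perm.SameCycle.setoid (contour H.rot Y))) <
        Nat.card (Quotient (Equiv.Perm.SameCycle.setoid (contour H.rot (Y \ {d.1})))) := by
      refine natCard_quotient_lt_of_le (a := d) (b := Dart.rev d)
        (fun x y (h : Equiv.Perm.SameCycle _ x y) => ?_)
        (fun hc => hr (H.reach_of_sameCycle_contour hc)) (H.sameCycle_contour_of_not_reach hd hr)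
      show Equiv.Perm.SameCycle _ x y
      rw [contour_eq_mul_swap d hd]
      exact h.mul_swap fun hc => hr (H.reach_of_sameCycle_contour hc)
    unfold eulerDefect
    omega

theorem eulerDefect_mono [Finite V] [Finite E] (h : X ⊆ Y) : H.eulerDefect X ≤ H.eulerDefect Y := by
  suffices ∀ Z : Set E, H.eulerDefect X ≤ H.eulerDefect (X ∪ Z) by
    have := this Y
    rwa [union_eq_self_of_subset_left h] at this
  intro Z
  induction Z, Z.toFinite using Set.Finite.induction_on with
  | empty => simp
  | @insert e Z _ _ ih =>
    by_cases he : e ∈ X ∪ Z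
    · rwa [union_insert, insert_eq_of_mem he]
    · have := H.eulerDefect_diff_le (d := (e, false)) (Y := X ∪ insert e Z) (by simp)
      rw [union_insert, insert_sdiff_self_of_notMem he, ← union_insert] at this
      exact ih.trans this

theorem vert_surjective [Nonempty E] : Function.Surjective H.vert := by
  intro v
  obtain ⟨e⟩ := ‹Nonempty E›
  exact (H.connected (H.vert (e, false)) v).induction (p := fun v => ∃ d, H.vert d = v) ⟨_, rfl⟩
    fun d _ _ _ => ⟨_, rfl⟩

theorem natCard_contours [Finite E] {W : Type*} {f : E × Bool → W} {σ : Equiv.Perm (E × Bool)}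
    (hf : Function.Surjective f) (h : ∀ d d', f d = f d' ↔ σ.SameCycle d d') :
    Nat.card (Quotient (Equiv.Perm.SameCycle.setoid σ)) = Nat.card W := by
  refine Nat.card_congr (Equiv.ofBijective
    (Quotient.lift f fun d d' (hd : σ.SameCycle d d') => (h d d').2 hd) ⟨?_, ?_⟩)
  · rintro ⟨d⟩ ⟨d'⟩ hd
    exact Quotient.sound ((h d d').1 hd)
  · intro w
    obtain ⟨d, rfl⟩ := hf w
    exact ⟨Quotient.mk _ d, rfl⟩

theorem eulerDefect_empty [Finite E] [Nonempty E] : H.eulerDefect ∅ = Nat.card V := by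
  have hrot : contour H.rot ∅ = H.rot := by
    ext1 d
    exact contour_of_notMem (notMem_empty _)
  have hV : Nat.card (Quotient (reachSetoid H.vert ∅)) = Nat.card V := by
    refine Nat.card_congr (Equiv.ofBijective (Quotient.mk _) ⟨fun u v huv => ?_, ?_⟩).symm
    · exact (Quotient.exact huv : Reach H.vert ∅ u v).induction (p := fun v => u = v) rfl
        fun d hd => absurd hd (notMem_empty _)
    · exact Quotient.mk_surjective
  unfold eulerDefect
  rw [hrot, natCard_contours H.vert_surjective H.vert_eq_iff, hV, ncard_empty]
  push_cast
  ring

theorem eulerDefect_univ [Finite E] [Nonempty E] : H.eulerDefect univ = Nat.card V := by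
  have hV : Nat.card (Quotient (reachSetoid H.vert univ)) = 1 := by
    rw [Nat.card_eq_one_iff_unique]
    obtain ⟨v⟩ := H.nonempty
    refine ⟨⟨?_⟩, ⟨Quotient.mk _ v⟩⟩
    rintro ⟨u⟩ ⟨w⟩
    exact Quotient.sound (H.connected u w)
  have heuler := H.euler
  unfold eulerDefect
  rw [natCard_contours (H.face_surjective ‹_›) H.face_eq_iff, hV, ncard_univ]
  omega

/-- The combinatorial form of the Jordan curve theorem: the two sides of an edge which lies on a
cycle of `Y` belong to different faces of the graph with edge set `Y`. -/
theorem not_sameCycle_contour_of_reach [Finite V] [Finite E] (hd : d.1 ∈ Y)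
    (h : Reach H.vert (Y \ {d.1}) (H.vert d) (H.vert (Dart.rev d))) :
    ¬ (contour H.rot Y).SameCycle d (Dart.rev d) := by
  intro hc
  have : Nonempty E := ⟨d.1⟩
  have h1 := H.eulerDefect_diff_lt hd h hc
  have h2 := H.eulerDefect_mono (empty_subset (Y \ {d.1}))
  have h3 := H.eulerDefect_mono (subset_univ Y)
  rw [eulerDefect_empty] at h2
  rw [eulerDefect_univ] at h3
  omega

/-- Two darts on one contour of `X` are on one contour of a subgraph as well if the subgraph
connects them: deleting an edge of a cycle joins two contours, and deleting a bridge splits a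
contour into two parts in different components. -/
theorem sameCycle_contour_of_subset [Finite V] [Finite E] (hYX : Y ⊆ X)
    (h : (contour H.rot X).SameCycle x y) (hxy : Reach H.vert Y (H.vert x) (H.vert y)) :
    (contour H.rot Y).SameCycle x y := by
  classical
  suffices ∀ Z : Set E, (contour H.rot (Y ∪ Z)).SameCycle x y →
      (contour H.rot Y).SameCycle x y by
    refine this X ?_
    rwa [union_eq_self_of_subset_left hYX]
  intro Z
  induction Z, Z.toFinite using Set.Finite.induction_on with
  | empty => simp
  | @insert e Z _ _ ih =>
    intro h
    by_cases he : e ∈ Y ∪ Z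
    · rw [union_insert, insert_eq_of_mem he] at h
      exact ih h
    refine ih ?_
    have hmem : ((e, false) : E × Bool).1 ∈ insert e (Y ∪ Z) := mem_insert _ _
    have hdiff : insert e (Y ∪ Z) \ {((e, false) : E × Bool).1} = Y ∪ Z :=
      insert_sdiff_self_of_notMem he
    rw [union_insert] at h
    by_cases hr : Reach H.vert (Y ∪ Z) (H.vert (e, false)) (H.vert (Dart.rev (e, false)))
    · have := h.mul_swap (H.not_sameCycle_contour_of_reach hmem (by rwa [hdiff]))
      rwa [← contour_diff_eq_mul_swap _ hmem, hdiff] at this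
    · rw [contour_eq_mul_swap _ hmem, hdiff] at h
      have hxy := hxy.mono (subset_union_left (t := Z))
      rcases h.of_mul_swap with h | ⟨h, h'⟩ | ⟨h, h'⟩
      · exact h
      · exact absurd (((H.reach_of_sameCycle_contour h).symm.trans hxy).trans
          (H.reach_of_sameCycle_contour h').symm) hr
      · exact absurd (((H.reach_of_sameCycle_contour h').trans hxy.symm).trans
          (H.reach_of_sameCycle_contour h)) hr

/-- If the complement of `Z` is connected, then its contours run through whole components of the
graph formed by the edges of `Z` in the dual graph. -/
theorem sameCycle_contour_compl_of_reach_face [Finite V] [Finite E] {Z : Set E} {x y : E × Bool}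
    (hconn : ∀ u v, Reach H.vert Zᶜ u v) (h : Reach H.face Z (H.face x) (H.face y)) :
    (contour H.rot Zᶜ).SameCycle x y := by
  have hface : ∀ z w, H.face z = H.face w → (contour H.rot Zᶜ).SameCycle z w := fun z w hzw =>
    H.sameCycle_contour_of_subset (subset_univ _) ((H.face_eq_iff _ _).1 hzw) (hconn _ _)
  refine h.induction (p := fun f => ∀ z, f = H.face z → (contour H.rot Zᶜ).SameCycle x z)
    (hface x) (fun d hd _ ih z hz => ?_) y rfl
  refine (ih d rfl).trans (Equiv.Perm.sameCycle_apply_left.1 (hface _ _ ?_))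
  rw [contour_of_notMem (notMem_compl_iff.2 hd), face_rot, hz]

/-- A contour of `Y` leaves a set `C` of vertices at most once, if within a subgraph `Z` of `Y`
without edges leaving `C` the ends on either side of the edges leaving `C` are connected. In terms
of the dual graph, a bond is a cycle, which passes through every face at most once. -/
theorem eq_of_sameCycle_contour_of_leave [Finite V] [Finite E] {Y Z : Set E} {C : Set V}
    {x y : E × Bool} (hZY : Z ⊆ Y)
    (hZC : ∀ d : E × Bool, d.1 ∈ Z → H.vert (Dart.rev d) ∈ C → H.vert d ∈ C)
    (hx : x.1 ∈ Y) (hy : y.1 ∈ Y) (hxC : H.vert x ∈ C) (hyC : H.vert y ∈ C)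
    (hxC' : H.vert (Dart.rev x) ∉ C) (hyC' : H.vert (Dart.rev y) ∉ C)
    (hin : Reach H.vert Z (H.vert x) (H.vert y))
    (hout : Reach H.vert Z (H.vert (Dart.rev x)) (H.vert (Dart.rev y)))
    (h : (contour H.rot Y).SameCycle x y) : x = y := by
  by_contra hne
  have hne1 : x.1 ≠ y.1 := by
    intro he
    rcases Dart.eq_or_eq_rev he with rfl | rfl
    · exact hne rfl
    · exact hyC' hxC
  have hnotZ : ∀ d : E × Bool, H.vert d ∈ C → H.vert (Dart.rev d) ∉ C → d.1 ∉ Z := by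
    intro d hd hd' hdZ
    exact hd' (hZC (Dart.rev d) hdZ (by rwa [Dart.rev_rev]))
  have hxZ := hnotZ x hxC hxC'
  have hyZ := hnotZ y hyC hyC'
  -- in the graph formed by `Z` and the two edges, both edges lie on a cycle
  set W : Set E := Z ∪ {x.1, y.1} with hW
  have hxW : x.1 ∈ W := Or.inr (Or.inl rfl)
  have hyW : y.1 ∈ W := Or.inr (Or.inr rfl)
  have hWY : W ⊆ Y := union_subset hZY (by rintro e (rfl | rfl) <;> assumption)
  have hxx : ¬ (contour H.rot W).SameCycle x (Dart.rev x) := by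
    have hsub : Z ⊆ W \ {x.1} := fun e he => ⟨Or.inl he, fun hex => hxZ (hex ▸ he)⟩
    exact H.not_sameCycle_contour_of_reach hxW (((hin.mono hsub).trans
      (Reach.of_mem ⟨hyW, hne1.symm⟩)).trans (hout.mono hsub).symm)
  have hyy : ¬ (contour H.rot W).SameCycle y (Dart.rev y) := by
    have hsub : Z ⊆ W \ {y.1} := fun e he => ⟨Or.inl he, fun hey => hyZ (hey ▸ he)⟩
    exact H.not_sameCycle_contour_of_reach hyW (((hin.mono hsub).symm.trans
      (Reach.of_mem ⟨hxW, hne1⟩)).trans (hout.mono hsub))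
  have hxy : (contour H.rot W).SameCycle x y :=
    H.sameCycle_contour_of_subset hWY h (hin.mono subset_union_left)
  -- so the contour of `x` and `y` has no dart along which it could return to `C`
  have hcyc : (contour H.rot W).SameCycle (contour H.rot W x) x :=
    Equiv.Perm.sameCycle_apply_left.2 (.refl _ _)
  refine hcyc.induction (p := fun z => H.vert z ∉ C) ?_ ?_ hxC
  · rwa [H.vert_contour_of_mem hxW]
  · intro z hz hzC hzC'
    have hxz := Equiv.Perm.sameCycle_apply_left.1 hz
    by_cases hzW : z.1 ∈ W
    · rw [H.vert_contour_of_mem hzW] at hzC'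
      rcases hzW with hzZ | hzx | hzy
      · exact hzC (hZC z hzZ hzC')
      · rcases Dart.eq_or_eq_rev hzx with rfl | rfl
        · exact hzC hxC
        · exact hxx hxz
      · rcases Dart.eq_or_eq_rev (d := y) hzy with rfl | rfl
        · exact hzC hyC
        · exact hyy (hxy.symm.trans hxz)
    · rw [H.vert_contour_of_notMem hzW] at hzC'
      exact hzC hzC'

/-! ### Regions -/

section Region

variable {T : Subg F E} {A B : H.Region T} {u v : V} {d x y : E × Bool}

theorem reach_of_region_eq (h : H.region T u = H.region T v) (e : E) :
    Reach H.vert (T.edgesᶜ \ {e}) u v :=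
  (Quotient.exact h).2 e

theorem region_eq_of_not_isBridge (hd : d.1 ∈ T.edgesᶜ) (h : ¬ IsBridge H.vert T.edgesᶜ d.1) :
    H.region T (H.vert (Dart.rev d)) = H.region T (H.vert d) := by
  refine (Quotient.sound ⟨Reach.of_mem hd, fun e => ?_⟩ :
    H.region T (H.vert d) = H.region T (H.vert (Dart.rev d))).symm
  by_cases he : d.1 = e
  · subst he
    by_contra hr
    exact h ((isBridge_iff d).2 ⟨hd, hr⟩)
  · exact Reach.of_mem ⟨hd, he⟩

theorem mem_innerEdges_iff (d : E × Bool) : d.1 ∈ H.innerEdges T A ↔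
    d.1 ∈ T.edgesᶜ ∧ H.region T (H.vert d) = A ∧ H.region T (H.vert (Dart.rev d)) = A := by
  obtain ⟨e, b⟩ := d
  cases b <;> simp [innerEdges, Dart.rev, and_comm]

theorem reach_inter_innerEdges [Finite E] {Y : Set E} (hY : Y ⊆ T.edgesᶜ) (h : Reach H.vert Y u v)
    (hu : H.region T u = A) (hv : H.region T v = A) :
    Reach H.vert (Y ∩ H.innerEdges T A) u v := by
  have h' := h.diff_bridges hY (H.reach_of_region_eq (hu.trans hv.symm))
  refine (h'.induction (p := fun w => H.region T w = A ∧ Reach H.vert (Y ∩ H.innerEdges T A) u w)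
    ⟨hu, .refl⟩ ?_).2
  intro d hd _ ⟨h1, h2⟩
  have h3 := (H.region_eq_of_not_isBridge (hY hd.1) hd.2).trans h1
  exact ⟨h3, h2.trans (Reach.of_mem ⟨hd.1, (H.mem_innerEdges_iff d).2 ⟨hY hd.1, h1, h3⟩⟩)⟩

theorem region_vert_around (h : H.region T (H.vert d) = A) :
    H.region T (H.vert (H.around T A d)) = A := by
  unfold around
  by_cases hd : d.1 ∈ H.innerEdges T A
  · rw [H.vert_contour_of_mem hd]
    exact ((H.mem_innerEdges_iff d).1 hd).2.2
  · rwa [H.vert_contour_of_notMem hd]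

/-- The bridges of the complement of a dual tree are the edges whose dual edge closes a cycle with
the tree; unless this cycle is a loop outside the tree, it passes through the tree. -/
theorem IsExit.face_mem [Finite V] [Finite E] (hT : H.IsDualTree T) (h : H.IsExit T A x)
    (hx : H.face x ∈ T.verts ∨ H.face x ≠ H.face (Dart.rev x)) : H.face x ∈ T.verts := by
  refine hx.elim id fun hne => ?_
  have hr := H.reach_face_of_sameCycle_contour
    (H.sameCycle_contour_of_not_reach h.1.1 h.1.not_reach)
  rcases Relation.ReflTransGen.cases_head hr with heq | ⟨_, ⟨d, hd, hd', _⟩, _⟩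
  · exact absurd heq hne
  · exact hd' ▸ hT.ends_mem d hd

theorem sameCycle_around_of_isExit [Finite V] [Finite E] (hT : H.IsDualTree T)
    (hconn : ∀ u v, Reach H.vert T.edgesᶜ u v) (hx : H.IsExit T A x) (hy : H.IsExit T A y)
    (hxT : H.face x ∈ T.verts) (hyT : H.face y ∈ T.verts) :
    (H.around T A).SameCycle x y := by
  refine H.sameCycle_contour_of_subset (fun e he => he.1)
    (H.sameCycle_contour_compl_of_reach_face hconn (hT.connected _ hxT _ hyT)) ?_
  exact (H.reach_inter_innerEdges Subset.rfl (hconn _ _) hx.2 hy.2).mono inter_subset_right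

/-- Two vertices of regions in the same subtree are connected by any graph which connects the
vertices of every region of this subtree and contains the bridges between these regions. -/
theorem reach_of_mem_subtree {W : Set E} {C : H.Region T} (h : C ∈ H.subtree T A B) (hB : B ≠ A)
    (hreg : ∀ u v, H.region T u ≠ A → H.region T u = H.region T v → Reach H.vert W u v)
    (hbr : ∀ d : E × Bool, IsBridge H.vert T.edgesᶜ d.1 → H.region T (H.vert d) ≠ A →
      H.target T d ≠ A → d.1 ∈ W)
    (hu : H.region T u = B) (hv : H.region T v = C) : Reach H.vert W u v := by
  replace h : Relation.ReflTransGen ((H.regionTree T).deleteIncidenceSet A).Adj B C :=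
    (SimpleGraph.reachable_iff_reflTransGen _ _).1 h
  suffices C ≠ A ∧ ∀ v, H.region T v = C → Reach H.vert W u v from this.2 v hv
  clear hv
  induction h with
  | refl => exact ⟨hB, fun v hv => hreg u v (hu ▸ hB) (hu.trans hv.symm)⟩
  | @tail C D _ hCD ih =>
    obtain ⟨⟨d, hd, rfl⟩, -, hD⟩ := (SimpleGraph.deleteIncidenceSet_adj).1 hCD
    refine ⟨hD, fun v hv => ?_⟩
    have hCA : H.region T (H.vert d) ≠ A := hd.2 ▸ ih.1
    exact ((ih.2 _ hd.2).trans (Reach.of_mem (hbr d hd.1 hCA hD))).trans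
      (hreg _ _ hD hv.symm)

theorem reachable_deleteIncidenceSet {W : Set E} (h : Reach H.vert W u v) (hW : W ⊆ T.edgesᶜ)
    (hA : ∀ w, Reach H.vert W u w → H.region T w ≠ A) :
    ((H.regionTree T).deleteIncidenceSet A).Reachable (H.region T u) (H.region T v) := by
  refine h.induction (p := fun w => ((H.regionTree T).deleteIncidenceSet A).Reachable
    (H.region T u) (H.region T w)) (SimpleGraph.Reachable.refl _) fun d hd hr ih => ?_
  by_cases hbr : IsBridge H.vert T.edgesᶜ d.1
  · refine ih.trans (SimpleGraph.Adj.reachable ?_)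
    exact SimpleGraph.deleteIncidenceSet_adj.2
      ⟨⟨d, ⟨hbr, rfl⟩, rfl⟩, hA _ hr, hA _ (hr.trans (Reach.of_mem hd))⟩
  · rwa [H.region_eq_of_not_isBridge (hW hd) hbr]

/-- The region graph has no cycle: different bridges leaving `A` lead to different subtrees. -/
theorem IsExit.eq_of_mem_subtree (hx : H.IsExit T A x) (hy : H.IsExit T A y)
    (h : H.target T y ∈ H.subtree T A (H.target T x)) : x = y := by
  by_contra hne
  have hne1 : y.1 ≠ x.1 := by
    intro he
    rcases Dart.eq_or_eq_rev he with rfl | rfl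
    · exact hne rfl
    · exact hx.target_ne H hy.2
  have h1 : Reach H.vert (T.edgesᶜ \ {x.1}) (H.vert (Dart.rev x)) (H.vert (Dart.rev y)) := by
    refine H.reach_of_mem_subtree h (hx.target_ne H) (fun u v _ huv => H.reach_of_region_eq huv _)
      (fun d hd hdA hdA' => ⟨hd.1, fun hdx => ?_⟩) rfl rfl
    rcases Dart.eq_or_eq_rev hdx with rfl | rfl
    · exact hdA hx.2
    · exact hdA' ((congrArg (fun z => H.region T (H.vert z)) (Dart.rev_rev x)).trans hx.2)
  have h2 : Reach H.vert (T.edgesᶜ \ {x.1}) (H.vert y) (H.vert (Dart.rev y)) :=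
    Reach.of_mem ⟨hy.1.1, hne1⟩
  exact hx.1.not_reach
    (((H.reach_of_region_eq (hx.2.trans hy.2.symm) x.1).trans h2).trans h1.symm)

theorem IsExit.eq_of_target_eq (hx : H.IsExit T A x) (hy : H.IsExit T A y)
    (h : H.target T x = H.target T y) : x = y :=
  hx.eq_of_mem_subtree H hy (h ▸ SimpleGraph.Reachable.refl _)

theorem totalWeight_eq_ncard [Finite V] (s : Set (H.Region T)) :
    H.totalWeight T s = {v | H.region T v ∈ s}.ncard := by
  classical
  have : Finite (H.Region T) := Quotient.finite _
  have := Fintype.ofFinite V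
  have := Fintype.ofFinite (H.Region T)
  rw [totalWeight, finsum_mem_eq_toFinset_sum, ncard_eq_toFinset_card',
    Finset.card_eq_sum_card_fiberwise (f := H.region T) (t := s.toFinset)]
  · refine Finset.sum_congr rfl fun B hB => ?_
    rw [weight, ncard_eq_toFinset_card']
    congr 1
    ext v
    simp only [mem_toFinset, mem_ofPred_eq, Finset.mem_filter] at hB ⊢
    exact ⟨fun h => ⟨h ▸ hB, h⟩, fun h => h.2⟩
  · intro v hv
    simpa using hv

theorem totalWeight_univ [Finite V] : H.totalWeight T univ = Nat.card V := by
  rw [totalWeight_eq_ncard]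
  simp [ncard_univ]

theorem WilsonStep.edges_subset {T T' : Subg F E} (h : H.WilsonStep T T') : T.edges ⊆ T'.edges := by
  obtain ⟨p, -, -, -, -, -, -, hp⟩ := h
  exact hp ▸ subset_union_left

theorem IsObtainedByRefining.subset {S : Set E} (h : H.IsObtainedByRefining T S) :
    S ⊆ T.edgesᶜ := by
  obtain ⟨-, T', hT', rfl⟩ := h
  refine compl_subset_compl.2 ?_
  induction hT' with
  | refl => exact Subset.rfl
  | tail _ hs ih => exact ih.trans (hs.edges_subset H)

/-! ### The two groups of neighbors -/

theorem isContiguous_of_exists_interval [Finite E] {N : Set (H.Region T)} (p : E × Bool → Prop)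
    (hN : ∀ x, H.IsExit T A x → (H.target T x ∈ N ↔ p x))
    (hp : ∀ x y, (H.around T A).SameCycle x y → p x → ¬ p (H.around T A x) →
      p y → ¬ p (H.around T A y) → x = y) : H.IsContiguous T A N := by
  intro c
  obtain ⟨d, k, h⟩ := Equiv.Perm.exists_interval (H.around T A) p c
    fun x y hx hy => hp x y (hx.symm.trans hy)
  exact ⟨d, k, fun x hx hc => (hN x hx).trans (h x hc)⟩

/-- If the splitting edge lies in `A`, then the neighbors of `A` are grouped by the component to
which they are attached. -/
theorem exists_groups_of_mem_innerEdges [Finite V] [Finite E] {S : Set E}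
    (hS : IsSpanningTree H.vert S) (hST : S ⊆ T.edgesᶜ) {e : E} (he : e ∈ S) (heA : e ∈ H.innerEdges T A)
    (hsplit : ∀ v, 2 * {u | Reach H.vert (S \ {e}) v u}.ncard = Nat.card V) :
    ∃ A₁ A₂ : Set (H.Region T),
      A₁ ∪ A₂ = (H.regionTree T).neighborSet A ∧ Disjoint A₁ A₂ ∧
      H.IsContiguous T A A₁ ∧ H.IsContiguous T A A₂ ∧
      2 * H.totalWeight T (⋃ B ∈ A₁, H.subtree T A B) ≤ H.totalWeight T univ ∧
      2 * H.totalWeight T (⋃ B ∈ A₂, H.subtree T A B) ≤ H.totalWeight T univ := by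
  have hconn : ∀ u v, Reach H.vert S u v := fun u v => hS.connected u trivial v trivial
  set C : Bool → Set V := fun b => {u | Reach H.vert (S \ {e}) (H.vert (e, b)) u} with hC
  have hdisj : ∀ v, v ∈ C false → v ∈ C true → False :=
    fun v (h : Reach _ _ _ _) (h' : Reach _ _ _ _) => (hS.acyclic e he).2 (h.trans h'.symm)
  have hcov : ∀ v, v ∈ C false ∨ v ∈ C true := by
    intro v
    rcases (hconn (H.vert (e, false)) v).avoid_or (e, false) with h | ⟨_, h⟩ | ⟨_, h⟩
    · exact Or.inl h
    · exact Or.inr h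
    · exact Or.inl h
  have hnot : ∀ b v, v ∉ C b → v ∈ C (!b) := by
    intro b v hv
    cases b
    · exact (hcov v).resolve_left hv
    · exact (hcov v).resolve_right hv
  -- the bridges out of `A` belong to `S`, and they are different from the splitting edge
  have hbridge : ∀ d : E × Bool, IsBridge H.vert T.edgesᶜ d.1 →
      ¬ (H.region T (H.vert d) = A ∧ H.target T d = A) → d.1 ∈ S \ {e} := fun d hd hdA =>
    ⟨hd.mem_of_subset hST hconn, fun hde => hdA ((H.mem_innerEdges_iff d).1 (hde ▸ heA)).2⟩
  set N : Bool → Set (H.Region T) := fun b =>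
    {B | ∃ x, H.IsExit T A x ∧ H.target T x = B ∧ H.vert x ∈ C b} with hN
  have hNC : ∀ b x, H.IsExit T A x → (H.target T x ∈ N b ↔ H.vert x ∈ C b) := by
    refine fun b x hx => ⟨?_, fun h => ⟨x, hx, rfl, h⟩⟩
    rintro ⟨y, hy, hxy, h⟩
    rwa [← hy.eq_of_target_eq H hx hxy]
  have hweight : ∀ b, 2 * H.totalWeight T (⋃ B ∈ N b, H.subtree T A B) ≤ H.totalWeight T univ := by
    intro b
    rw [totalWeight_univ, ← hsplit (H.vert (e, b)), totalWeight_eq_ncard]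
    refine Nat.mul_le_mul_left 2 (ncard_le_ncard (fun v hv => ?_) (toFinite _))
    obtain ⟨B, hB, hv⟩ := mem_iUnion₂.1 hv
    obtain ⟨x, hx, rfl, hxC⟩ := hB
    refine (Reach.trans hxC (Reach.of_mem (hbridge x hx.1 fun h => hx.target_ne H h.2))).trans
      (H.reach_of_mem_subtree hv (hx.target_ne H) (fun u w hu huw => ?_)
        (fun d hd h _ => hbridge d hd fun h' => h h'.1) rfl rfl)
    refine (H.reach_inter_innerEdges hST (hconn u w) rfl huw.symm).mono fun f hf => ⟨hf.1, ?_⟩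
    rintro rfl
    exact hu ((hf.2.2 false).symm.trans (heA.2 false))
  have hcontig : ∀ b, H.IsContiguous T A (N b) := by
    intro b
    refine H.isContiguous_of_exists_interval (fun z => H.vert z ∈ C b ∧ H.region T (H.vert z) = A)
      (fun x hx => (hNC b x hx).trans (and_iff_left hx.2).symm) ?_
    have hleave : ∀ z, (H.vert z ∈ C b ∧ H.region T (H.vert z) = A) →
        ¬ (H.vert (H.around T A z) ∈ C b ∧ H.region T (H.vert (H.around T A z)) = A) →
        z.1 ∈ H.innerEdges T A ∧ H.vert (Dart.rev z) ∉ C b := by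
      intro z hz hz'
      have hz'' : H.vert (H.around T A z) ∉ C b := fun h => hz' ⟨h, H.region_vert_around hz.2⟩
      unfold around at hz''
      by_cases hzA : z.1 ∈ H.innerEdges T A
      · exact ⟨hzA, by rwa [H.vert_contour_of_mem hzA] at hz''⟩
      · rw [H.vert_contour_of_notMem hzA] at hz''
        exact absurd hz.1 hz''
    intro x y hxy hx hx' hy hy'
    obtain ⟨hxA, hxC⟩ := hleave x hx hx'
    obtain ⟨hyA, hyC⟩ := hleave y hy hy'
    have hinner : ∀ b u v, u ∈ C b → v ∈ C b → H.region T u = A → H.region T v = A →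
        Reach H.vert ((S \ {e}) ∩ H.innerEdges T A) u v :=
      fun b u v (hu : Reach _ _ _ _) (hv : Reach _ _ _ _) huA hvA =>
        H.reach_inter_innerEdges (sdiff_subset.trans hST) (hu.symm.trans hv) huA hvA
    refine H.eq_of_sameCycle_contour_of_leave (C := C b) inter_subset_right (fun d hd h => ?_)
      hxA hyA hx.1 hy.1 hxC hyC (hinner b _ _ hx.1 hy.1 hx.2 hy.2)
      (hinner (!b) _ _ (hnot b _ hxC) (hnot b _ hyC) ((H.mem_innerEdges_iff x).1 hxA).2.2
        ((H.mem_innerEdges_iff y).1 hyA).2.2) hxy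
    exact Reach.trans h (Reach.of_mem hd.1).symm
  refine ⟨N false, N true, ?_, ?_, hcontig _, hcontig _, hweight _, hweight _⟩
  · ext B
    constructor
    · rintro (⟨x, hx, rfl, _⟩ | ⟨x, hx, rfl, _⟩) <;> exact ⟨x, hx, rfl⟩
    · rintro ⟨x, hx, rfl⟩
      exact (hcov (H.vert x)).imp (fun h => ⟨x, hx, rfl, h⟩) (fun h => ⟨x, hx, rfl, h⟩)
  · refine disjoint_left.2 ?_
    rintro _ ⟨x, hx, rfl, h⟩ h'
    exact hdisj _ h ((hNC true x hx).1 h')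

/-- If the splitting edge does not lie in `A`, then a half of the vertices lies in the subtree of a
single neighbor of `A`, which is opposed to all others. -/
theorem exists_groups_of_notMem_innerEdges [Finite V] [Finite E] (hA : H.IsVertexCenter T A)
    {S : Set E} (hS : IsSpanningTree H.vert S)
    (hST : S ⊆ T.edgesᶜ) {e : E} (he : e ∈ S) (heA : e ∉ H.innerEdges T A)
    (hsplit : ∀ v, 2 * {u | Reach H.vert (S \ {e}) v u}.ncard = Nat.card V) :
    ∃ A₁ A₂ : Set (H.Region T),
      A₁ ∪ A₂ = (H.regionTree T).neighborSet A ∧ Disjoint A₁ A₂ ∧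
      H.IsContiguous T A A₁ ∧ H.IsContiguous T A A₂ ∧
      2 * H.totalWeight T (⋃ B ∈ A₁, H.subtree T A B) ≤ H.totalWeight T univ ∧
      2 * H.totalWeight T (⋃ B ∈ A₂, H.subtree T A B) ≤ H.totalWeight T univ := by
  have hconn : ∀ u v, Reach H.vert S u v := fun u v => hS.connected u trivial v trivial
  have hSe : S \ {e} ⊆ T.edgesᶜ := sdiff_subset.trans hST
  -- `S` without the splitting edge still connects `A`, so one of its components avoids `A`
  have hreachA : ∀ u v, H.region T u = A → H.region T v = A → Reach H.vert (S \ {e}) u v :=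
    fun u v hu hv => (H.reach_inter_innerEdges hST (hconn u v) hu hv).mono
      fun f hf => ⟨hf.1, fun hfe => heA (hfe ▸ hf.2)⟩
  obtain ⟨v₀, hv₀⟩ : ∃ v₀, ∀ w, Reach H.vert (S \ {e}) v₀ w → H.region T w ≠ A := by
    by_contra! h
    obtain ⟨u, hu, huA⟩ := h (H.vert (e, false))
    obtain ⟨w, hw, hwA⟩ := h (H.vert (e, true))
    exact (hS.acyclic e he).2 ((hu.trans (hreachA u w huA hwA)).trans hw.symm)
  set C : Set V := {u | Reach H.vert (S \ {e}) v₀ u} with hC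
  set N₁ : Set (H.Region T) := {B | (H.regionTree T).Adj A B ∧
    ∃ u ∈ C, H.region T u ∈ H.subtree T A B} with hN₁
  set N₂ : Set (H.Region T) := {B | (H.regionTree T).Adj A B ∧
    ¬ ∃ u ∈ C, H.region T u ∈ H.subtree T A B} with hN₂
  have hunique : ∀ x y, H.IsExit T A x ∧ H.target T x ∈ N₁ → H.IsExit T A y ∧ H.target T y ∈ N₁ →
      x = y := by
    rintro x y ⟨hx, -, u, hu, hux⟩ ⟨hy, -, w, hw, hwy⟩
    have huw := H.reachable_deleteIncidenceSet (Reach.trans (Reach.symm hu) hw) hSe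
      fun z hz => hv₀ z (Reach.trans hu hz)
    exact hx.eq_of_mem_subtree H hy
      (SimpleGraph.Reachable.trans hux (huw.trans (SimpleGraph.Reachable.symm hwy)))
  refine ⟨N₁, N₂, ?_, ?_, ?_, ?_, ?_, ?_⟩
  · ext B
    simp only [hN₁, hN₂, mem_union, mem_ofPred_eq, ← and_or_left, em, and_true,
      SimpleGraph.mem_neighborSet]
  · exact disjoint_left.2 fun B h h' => h'.2 h.2
  · refine H.isContiguous_of_exists_interval (fun z => H.IsExit T A z ∧ H.target T z ∈ N₁)
      (fun x hx => iff_and_self.2 fun _ => hx) fun x y _ hx _ hy _ => hunique x y hx hy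
  · refine H.isContiguous_of_exists_interval (fun z => ¬ (H.IsExit T A z ∧ H.target T z ∈ N₁))
      (fun x hx => ?_) fun x y _ _ hx _ hy => ?_
    · have : (H.regionTree T).Adj A (H.target T x) := ⟨x, hx, rfl⟩
      simp [hN₁, hN₂, hx, this]
    · exact (H.around T A).injective (hunique _ _ (not_not.1 hx) (not_not.1 hy))
  · have hsub : N₁.Subsingleton := by
      intro B hB B' hB'
      obtain ⟨x, hx, rfl⟩ := hB.1
      obtain ⟨y, hy, rfl⟩ := hB'.1
      rw [hunique x y ⟨hx, hB⟩ ⟨hy, hB'⟩]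
    rcases hsub.eq_empty_or_singleton with h | ⟨B, h⟩
    · simp [h, totalWeight]
    · have hB : B ∈ N₁ := h ▸ mem_singleton B
      rw [h, biUnion_singleton]
      exact hA B hB.1.ne'
  · rw [totalWeight_univ, totalWeight_eq_ncard]
    have hle : {v | H.region T v ∈ ⋃ B ∈ N₂, H.subtree T A B}.ncard ≤ Cᶜ.ncard := by
      refine ncard_le_ncard (fun v hv hvC => ?_) (toFinite _)
      obtain ⟨B, hB, hv⟩ := mem_iUnion₂.1 hv
      exact hB.2 ⟨v, hvC, hv⟩
    have hcompl := ncard_add_ncard_compl C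
    have : 2 * C.ncard = Nat.card V := hsplit v₀
    omega

end Region

end PlaneGraph

theorem mainTheorem6 {V E F : Type*} [Finite V] [Finite E] [Finite F] (H : PlaneGraph V E F)
    (T : Subg F E) (hT : H.IsDualTree T) (A : H.Region T) (hA : H.IsVertexCenter T A)
    (S : Set E) (hS : H.IsObtainedByRefining T S) (hsplit : IsSplittable H.vert 0 S) :
    (∀ x y, H.IsExit T A x → H.IsExit T A y →
      (H.face x ∈ T.verts ∨ H.face x ≠ H.face (Dart.rev x)) →
      (H.face y ∈ T.verts ∨ H.face y ≠ H.face (Dart.rev y)) →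
      (H.around T A).SameCycle x y) ∧
    ∃ A₁ A₂ : Set (H.Region T),
      A₁ ∪ A₂ = (H.regionTree T).neighborSet A ∧ Disjoint A₁ A₂ ∧
      H.IsContiguous T A A₁ ∧ H.IsContiguous T A A₂ ∧
      2 * H.totalWeight T (⋃ B ∈ A₁, H.subtree T A B) ≤ H.totalWeight T univ ∧
      2 * H.totalWeight T (⋃ B ∈ A₂, H.subtree T A B) ≤ H.totalWeight T univ := by
  have hST := hS.subset H
  refine ⟨fun x y hx hy hxT hyT => ?_, ?_⟩
  · exact H.sameCycle_around_of_isExit hT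
      (fun u v => (hS.1.connected u trivial v trivial).mono hST) hx hy
      (hx.face_mem H hT hxT) (hy.face_mem H hT hyT)
  · obtain ⟨e, he, hsplit⟩ := hsplit
    have hhalf : ∀ v, 2 * {u | Reach H.vert (S \ {e}) v u}.ncard = Nat.card V := by
      intro v
      have h0 := abs_nonpos_iff.1 (hsplit v)
      have h1 : (2 * {u | Reach H.vert (S \ {e}) v u}.ncard : ℝ) = Nat.card V := by linarith
      exact_mod_cast h1
    by_cases heA : e ∈ H.innerEdges T A
    · exact H.exists_groups_of_mem_innerEdges hS.1 hST he heA hhalf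
    · exact H.exists_groups_of_notMem_innerEdges hA hS.1 hST he heA hhalf
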